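/- Let $\rho = 1+\sqrt2$. The silver stepsize schedules $\pi^{(m)} = (\pi^{(m)}_0,\dots,\pi^{(m)}_{2^m-2})$, $m\ge 1$, are defined by $\pi^{(1)} = [\sqrt 2]$ and $\pi^{(m+1)} = [\pi^{(m)},\, 1+\rho^{m-1},\, \pi^{(m)}]$ (concatenation). Call $h:\mathbb{R}^d\to\mathbb{R}$ $L$-smooth if it is differentiable and $\|\nabla h(x)-\nabla h(y)\|\le L\|x-y\|$ for all $x,y\in\mathbb{R}^d$, where $\|\cdot\|$ is the Euclidean norm. Let $m\ge 1$, $N = 2^m-1$, $d \ge 0$ and $L>0$. Let $h:\mathbb{R}^d\to\mathbb{R}$ be any $L$-smooth convex function, $x^\star$ any minimizer of $h$, $x^0\in\mathbb{R}^d$ any initial point, and let $x^1,\dots,x^N$ be given by gradient descent with the silver schedule, $$x^{k+1} = x^k - \frac{\pi^{(m)}_k}{L}\nabla h(x^k),\qquad k=0,\dots,N-1 .$$ Then $$h(x^N)-h(x^\star)\le \frac{L\|x^0-x^\star\|^2}{2\bigl(2\sum_{i=0}^{2^m-2}\pi^{(m)}_i+1\bigr)} = \frac{L\|x^0-x^\star\|^2}{4\rho^m-2},$$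 $$\|\nabla h(x^N)\|\le \frac{L\|x^0-x^\star\|}{\sum_{i=0}^{2^m-2}\pi^{(m)}_i+1} = \frac{L\|x^0-x^\star\|}{\rho^m}.$$ Furthermore, both bounds are tight: for all $m\ge1$, $d$, $L>0$ as above and all $x^0\neq x^\star$ in $\mathbb{R}^d$, there is an $L$-smooth convex function $h:\mathbb{R}^d\to\mathbb{R}$ with minimizer $x^\star$ for which the first bound holds with equality, and there is (possibly another) such function for which the second bound holds with equality. -/

import Mathlib

/-- The silver ratio `ρ = 1 + √2`. -/
noncomputable def silverRatio : ℝ := 1 + Real.sqrt 2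

/-- The silver stepsize schedule `π^(m)`: `π^(1) = [√2]` and
`π^(m+1) = [π^(m), 1 + ρ^(m-1), π^(m)]` for `m ≥ 1`.
(The schedule is only considered for `m ≥ 1`; the value at `0` is the empty schedule.) -/
noncomputable def silverSchedule : ℕ → List ℝ
  | 0 => []
  | 1 => [Real.sqrt 2]
  | m + 2 => silverSchedule (m + 1) ++ [1 + silverRatio ^ m] ++ silverSchedule (m + 1)

/-- The schedule `π^(m)` has `2^m - 1` entries. -/
theorem silverSchedule_length (m : ℕ) : (silverSchedule m).length = 2 ^ m - 1 := by
  induction m using silverSchedule.induct with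
  | case1 => simp [silverSchedule]
  | case2 => simp [silverSchedule]
  | case3 m ih =>
    have h : 0 < 2 ^ m := by positivity
    simp only [silverSchedule, List.length_append, List.length_cons, List.length_nil, ih]
    rw [pow_succ 2 (m + 1), pow_succ 2 m]
    omega

/-- `h` is `L`-smooth on `ℝ^d`: it is differentiable and its gradient is Lipschitz continuous
with constant `L` with respect to the Euclidean norm. -/
def IsLSmooth {d : ℕ} (L : ℝ) (h : EuclideanSpace ℝ (Fin d) → ℝ) : Prop :=
  Differentiable ℝ h ∧ ∀ x y, ‖gradient h x - gradient h y‖ ≤ L * ‖x - y‖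

/-- The points `x 0, …, x N` are the iterates of the `N`-step gradient descent method on `h`,
started at `x₀`, with stepsizes `α` normalized by `L`, where `N` is the length of `α`:
`x 0 = x₀` and `x (k+1) = x k - (α_k / L) ∇h(x k)` for `k = 0, …, N - 1`.
(Values of `x` beyond the index `N` play no role.) -/
def IsGradientDescent {d : ℕ} (L : ℝ) (h : EuclideanSpace ℝ (Fin d) → ℝ) (α : List ℝ)
    (x₀ : EuclideanSpace ℝ (Fin d)) (x : ℕ → EuclideanSpace ℝ (Fin d)) : Prop :=
  x 0 = x₀ ∧ ∀ (k : ℕ) (hk : k < α.length), x (k + 1) = x k - (α[k] / L) • gradient h (x k)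

/-! ### Potential function and the upper bounds. -/

section Certificate

variable {E : Type*} [NormedAddCommGroup E] [InnerProductSpace ℝ E]

open scoped RealInnerProductSpace

/-! After scaling to L = 1, the upper bounds follow from the potential inequality
`HasPotentialBound`, with S the sum of the steps. It survives the recursion of the schedule
(`HasPotentialBound.join`) because the reference point is arbitrary: the second block can be
compared with the end of the first block and with its own end, as well as with y. The identity ρ² =
2ρ + 1 is what makes the sums and the multipliers match. At a minimizer the potential gives both
rates (`HasPotentialBound.rates`).

Tightness comes from one-dimensional Huber functions whose iterates never leave the affine part, so
that only S matters (`exists_huber_descent`). -/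

/-- The interpolation inequality of a `1`-smooth convex function `f` with gradient map `g`. -/
def IsCocoercive (f : E → ℝ) (g : E → E) : Prop :=
  ∀ x y, f y + ⟪g y, x - y⟫ + ‖g x - g y‖ ^ 2 / 2 ≤ f x

/-- `x 0, …, x l.length` are obtained by descent along `g` with stepsizes `l`. -/
def IsDescentPath (g : E → E) (l : List ℝ) (x : ℕ → E) : Prop :=
  ∀ (k : ℕ) (hk : k < l.length), x (k + 1) = x k - l[k] • g (x k)

/-- The potential decrease along descent paths with stepsizes `l` of sum `S`, relative to an
arbitrary reference point `y`. -/
def HasPotentialBound (f : E → ℝ) (g : E → E) (l : List ℝ) (S : ℝ) : Prop :=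
  ∀ x : ℕ → E, IsDescentPath g l x → ∀ y : E,
    ‖x l.length - (y - g y)‖ ^ 2 + S * (S + 1) * ‖g (x l.length)‖ ^ 2
      + 2 * S * (f (x l.length) - f y + ‖g y‖ ^ 2 / 2) ≤ ‖x 0 - (y - g y)‖ ^ 2

theorem IsDescentPath.append_left {g : E → E} {l₁ l₂ : List ℝ} {x : ℕ → E}
    (h : IsDescentPath g (l₁ ++ l₂) x) : IsDescentPath g l₁ x := by
  intro k hk
  have := h k (by simp; omega)
  rwa [List.getElem_append_left hk] at this

theorem IsDescentPath.append_right {g : E → E} {l₁ l₂ : List ℝ} {x : ℕ → E}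
    (h : IsDescentPath g (l₁ ++ l₂) x) :
    IsDescentPath g l₂ (fun k => x (l₁.length + k)) := by
  intro k hk
  have := h (l₁.length + k) (by simp; omega)
  rw [List.getElem_append_right (by omega)] at this
  simpa [add_assoc] using this

/-- Here a ends the first block and b the second. The claim is a nonnegative combination of four
block inequalities and three cocoercivity inequalities. -/
theorem IsCocoercive.potential_join {f : E → ℝ} {g : E → E} (hfg : IsCocoercive f g)
    {ρ r D : ℝ} (hρ : ρ ^ 2 = 2 * ρ + 1) (hρ0 : 0 ≤ ρ) (hr : 0 ≤ r) {a b y : E}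
    (hA : ‖a - (y - g y)‖ ^ 2 + (ρ * r - 1) * (ρ * r - 1 + 1) * ‖g a‖ ^ 2
      + 2 * (ρ * r - 1) * (f a - f y + ‖g y‖ ^ 2 / 2) ≤ D)
    (hB : ∀ z, ‖b - (z - g z)‖ ^ 2 + (ρ * r - 1) * (ρ * r - 1 + 1) * ‖g b‖ ^ 2
      + 2 * (ρ * r - 1) * (f b - f z + ‖g z‖ ^ 2 / 2) ≤ ‖a - (1 + r) • g a - (z - g z)‖ ^ 2) :
    ‖b - (y - g y)‖ ^ 2 + (ρ ^ 2 * r - 1) * (ρ ^ 2 * r - 1 + 1) * ‖g b‖ ^ 2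
      + 2 * (ρ ^ 2 * r - 1) * (f b - f y + ‖g y‖ ^ 2 / 2) ≤ D := by
  -- Using w in place of b turns everything into inner products of w and the gradients.
  obtain ⟨w, rfl⟩ : ∃ w, b = a - g a - w := ⟨a - g a - b, by abel⟩
  set b := a - g a - w with hb
  have B := hB y
  have C := hB a
  have CN := hB b
  have Q := hfg y a
  have Q₁ := hfg a b
  have Q₂ := hfg b a
  have e₀ : ‖a - (1 + r) • g a - (y - g y)‖ ^ 2 = ‖a - (y - g y)‖ ^ 2
      - 2 * (1 + r) * ⟪g a, a - (y - g y)⟫ + (1 + r) ^ 2 * ‖g a‖ ^ 2 := by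
    rw [show a - (1 + r) • g a - (y - g y) = (a - (y - g y)) - (1 + r) • g a by abel,
      norm_sub_sq_real, real_inner_smul_right, norm_smul, mul_pow, Real.norm_eq_abs, sq_abs,
      real_inner_comm]
    ring
  have e₁ : ⟪g a, a - (y - g y)⟫ = -⟪g a, y - a⟫ + ⟪g y, g a⟫ := by
    rw [real_inner_comm (g a) (g y), ← inner_neg_right, ← inner_add_right]
    congr 1; abel
  have e₂ : ‖a - (1 + r) • g a - (a - g a)‖ ^ 2 = r ^ 2 * ‖g a‖ ^ 2 := by
    rw [show a - (1 + r) • g a - (a - g a) = -(r • g a) by rw [add_smul, one_smul]; abel,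
      norm_neg, norm_smul, mul_pow, Real.norm_eq_abs, sq_abs]
  have e₃ : ‖b - (a - g a)‖ ^ 2 = ‖w‖ ^ 2 := by
    rw [hb, show a - g a - w - (a - g a) = -w by abel, norm_neg]
  have e₄ : ‖a - (1 + r) • g a - (b - g b)‖ ^ 2 = ‖w‖ ^ 2 + r ^ 2 * ‖g a‖ ^ 2 + ‖g b‖ ^ 2
      - 2 * r * ⟪g a, w⟫ + 2 * ⟪g b, w⟫ - 2 * r * ⟪g a, g b⟫ := by
    rw [show a - (1 + r) • g a - (b - g b) = w - r • g a + g b by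
      rw [hb, add_smul, one_smul]; abel, norm_add_sq_real, norm_sub_sq_real, inner_sub_left,
      real_inner_smul_left, real_inner_smul_right, norm_smul, mul_pow, Real.norm_eq_abs, sq_abs,
      real_inner_comm w (g a), real_inner_comm (g b) w]
    ring
  have e₅ : ‖b - (b - g b)‖ ^ 2 = ‖g b‖ ^ 2 := by rw [sub_sub_cancel]
  have e₆ : ⟪g b, a - b⟫ = ⟪g b, w⟫ + ⟪g a, g b⟫ := by
    rw [real_inner_comm (g b) (g a), ← inner_add_right]
    congr 1; rw [hb]; abel
  have e₇ : ⟪g a, b - a⟫ = -⟪g a, w⟫ - ‖g a‖ ^ 2 := by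
    rw [← real_inner_self_eq_norm_sq, ← inner_neg_right, ← inner_sub_right]
    congr 1; rw [hb]; abel
  rw [e₀, e₁] at B
  rw [e₂, e₃] at C
  rw [e₄, e₅] at CN
  rw [norm_sub_sq_real] at Q Q₁ Q₂
  rw [e₆] at Q₁
  rw [e₇, real_inner_comm (g a) (g b)] at Q₂
  -- Multipliers: 1 for `hA` and `B`, 2(1 + r) to cancel ⟪g a, y - a⟫ in `B`, and ρ, ρ, 2ρ, 2ρr for
  -- the rest.
  have Q' := mul_nonneg (by positivity : 0 ≤ 2 * (1 + r)) (sub_nonneg.2 Q)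
  have C' := mul_nonneg hρ0 (sub_nonneg.2 C)
  have CN' := mul_nonneg hρ0 (sub_nonneg.2 CN)
  have Q₁' := mul_nonneg (by positivity : 0 ≤ 2 * ρ) (sub_nonneg.2 Q₁)
  have Q₂' := mul_nonneg (by positivity : 0 ≤ 2 * ρ * r) (sub_nonneg.2 Q₂)
  refine sub_nonneg.1 (le_of_le_of_eq (add_nonneg (add_nonneg (add_nonneg (add_nonneg (add_nonneg
    (add_nonneg (sub_nonneg.2 hA) (sub_nonneg.2 B)) Q') C') CN') Q₁') Q₂') ?_)
  linear_combination -(-2 * r * (f a - f y) + (r ^ 2 + r) * ‖g a‖ ^ 2 - r ^ 2 * ρ ^ 2 * ‖g b‖ ^ 2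
    - r * ‖g y‖ ^ 2) * hρ

theorem HasPotentialBound.join {f : E → ℝ} {g : E → E} (hfg : IsCocoercive f g)
    {ρ r : ℝ} (hρ : ρ ^ 2 = 2 * ρ + 1) (hρ0 : 0 ≤ ρ) (hr : 0 ≤ r) {l : List ℝ}
    (hl : HasPotentialBound f g l (ρ * r - 1)) :
    HasPotentialBound f g (l ++ [1 + r] ++ l) (ρ ^ 2 * r - 1) := by
  intro x hx y
  have h₁ := hx.append_left
  have hA := hl x h₁.append_left y
  have hB := hl _ hx.append_right
  have hstep := h₁ l.length (by simp)
  simp only [List.length_append, List.length_cons, List.length_nil, zero_add, add_zero,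
    List.getElem_concat_length] at hstep hB ⊢
  rw [hstep] at hB
  exact hfg.potential_join hρ hρ0 hr hA hB

theorem silverRatio_pos : 0 < silverRatio := by unfold silverRatio; positivity

theorem silverRatio_sq : silverRatio ^ 2 = 2 * silverRatio + 1 := by
  have := Real.sq_sqrt (show (0 : ℝ) ≤ 2 by norm_num)
  unfold silverRatio
  linear_combination this

/-- The base case is itself a join of two empty blocks, with r = ρ⁻¹, hence S = ρr - 1 = 0. -/
theorem silverSchedule_one :
    silverSchedule 1 = silverSchedule 0 ++ [1 + silverRatio⁻¹] ++ silverSchedule 0 := by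
  have h : silverRatio⁻¹ = Real.sqrt 2 - 1 := by
    refine inv_eq_of_mul_eq_one_right ?_
    have := Real.sq_sqrt (show (0 : ℝ) ≤ 2 by norm_num)
    unfold silverRatio
    linear_combination this
  simp [silverSchedule, h]

theorem IsCocoercive.silver_bound {f : E → ℝ} {g : E → E} (hfg : IsCocoercive f g) (m : ℕ) :
    HasPotentialBound f g (silverSchedule m) (silverRatio ^ m - 1) := by
  have hρ := silverRatio_pos
  induction m using silverSchedule.induct with
  | case1 => intro x _ y; simp [silverSchedule]
  | case2 =>
    rw [silverSchedule_one]
    have h₀ : HasPotentialBound f g (silverSchedule 0) (silverRatio * silverRatio⁻¹ - 1) := by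
      intro x _ y
      simp [silverSchedule, hρ.ne']
    have := h₀.join hfg silverRatio_sq hρ.le (inv_nonneg.2 hρ.le)
    rw [pow_one]
    rwa [sq, mul_assoc, mul_inv_cancel₀ hρ.ne', mul_one] at this
  | case3 m ih =>
    rw [pow_succ'] at ih
    have := ih.join hfg silverRatio_sq hρ.le (by positivity)
    rwa [← pow_add, add_comm 2 m] at this

theorem silverSchedule_sum (m : ℕ) : (silverSchedule m).sum = silverRatio ^ m - 1 := by
  induction m using silverSchedule.induct with
  | case1 => simp [silverSchedule]
  | case2 => simp [silverSchedule, silverRatio]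
  | case3 m ih =>
    simp only [silverSchedule, List.sum_append, List.sum_cons, List.sum_nil, ih]
    change _ = silverRatio ^ (m + 2) - 1
    linear_combination -silverRatio ^ m * silverRatio_sq

theorem silverSchedule_nonneg (m : ℕ) : ∀ a ∈ silverSchedule m, 0 ≤ a := by
  have hρ := silverRatio_pos
  induction m using silverSchedule.induct with
  | case1 => simp [silverSchedule]
  | case2 => simp [silverSchedule]
  | case3 m ih =>
    intro a ha
    simp only [silverSchedule, List.mem_append, List.mem_singleton] at ha
    rcases ha with (ha | rfl) | ha
    · exact ih a ha
    · positivity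
    · exact ih a ha

/-- The potential bound at a stationary point yields the rates for the function value and for the
gradient. -/
theorem HasPotentialBound.rates {f : E → ℝ} {g : E → E} (hfg : IsCocoercive f g)
    {l : List ℝ} {S : ℝ} (hS : 0 ≤ S) (hl : HasPotentialBound f g l S) {x : ℕ → E}
    (hx : IsDescentPath g l x) {y : E} (hy : g y = 0) :
    (2 * (2 * S + 1)) * (f (x l.length) - f y) ≤ ‖x 0 - y‖ ^ 2 ∧
      (S + 1) * ‖g (x l.length)‖ ≤ ‖x 0 - y‖ := by
  have h := hl x hx y
  set b := x l.length
  have Q₁ := hfg b y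
  have Q₂ := hfg y b
  simp only [hy, sub_zero, zero_sub, norm_neg, inner_zero_left, norm_zero] at h Q₁ Q₂
  have e : ⟪g b, y - b⟫ = -⟪g b, b - y⟫ := by rw [← inner_neg_right, neg_sub]
  have hcs := real_inner_le_norm (g b) (b - y)
  rw [e] at Q₂
  have hn : ‖g b‖ ≤ ‖b - y‖ := by
    by_contra! hlt
    nlinarith [norm_nonneg (b - y)]
  constructor
  -- Scale `Q₂` by 2(S + 1); after Cauchy–Schwarz the slack is exactly this square.
  · nlinarith [sq_nonneg (‖b - y‖ - (S + 1) * ‖g b‖)]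
  · refine abs_le_of_sq_le_sq' ?_ (norm_nonneg _) |>.2
    have h₁ := mul_le_mul_of_nonneg_left Q₁ hS
    nlinarith [pow_le_pow_left₀ (norm_nonneg _) hn 2]

end Certificate

/-! ### Convex L-smooth functions. -/

section Smooth

open scoped RealInnerProductSpace

variable {d : ℕ} {L : ℝ} {h : EuclideanSpace ℝ (Fin d) → ℝ}

theorem Differentiable.hasDerivAt_line (hd : Differentiable ℝ h) (x v : EuclideanSpace ℝ (Fin d))
    (t : ℝ) : HasDerivAt (fun s : ℝ => h (x + s • v)) ⟪gradient h (x + t • v), v⟫ t := by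
  have h₁ : HasDerivAt (fun s : ℝ => x + s • v) v t := by
    simpa using ((hasDerivAt_id t).smul_const v).const_add x
  have h₂ := (hd (x + t • v)).hasFDerivAt.comp_hasDerivAt t h₁
  rwa [← inner_gradient_left] at h₂

/-- The subgradient inequality for a differentiable convex function. -/
theorem ConvexOn.gradient_le (hc : ConvexOn ℝ Set.univ h) (hd : Differentiable ℝ h)
    (x y : EuclideanSpace ℝ (Fin d)) : h x + ⟪gradient h x, y - x⟫ ≤ h y := by
  have h₁ : ConvexOn ℝ Set.univ (fun s : ℝ => h (x + s • (y - x))) := by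
    refine ⟨convex_univ, fun s _ t _ a b ha hb hab => ?_⟩
    refine le_of_eq_of_le ?_ (hc.2 (Set.mem_univ (x + s • (y - x)))
      (Set.mem_univ (x + t • (y - x))) ha hb hab)
    simp only
    congr 1
    rw [smul_add, smul_add, add_add_add_comm, ← add_smul, hab, one_smul, add_smul, smul_smul,
      smul_smul, smul_eq_mul, smul_eq_mul]
  have h₂ := h₁.le_slope_of_hasDerivAt (Set.mem_univ 0) (Set.mem_univ 1) zero_lt_one
    (hd.hasDerivAt_line x (y - x) 0)
  simp [slope_def_field, -inner_gradient_left] at h₂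
  linarith

/-- The descent lemma. -/
theorem IsLSmooth.le_quadratic (hL : IsLSmooth L h) (x v : EuclideanSpace ℝ (Fin d)) :
    h (x + v) ≤ h x + ⟪gradient h x, v⟫ + L / 2 * ‖v‖ ^ 2 := by
  have hd (t : ℝ) : HasDerivAt (fun s : ℝ => h (x + s • v) - (s * ⟪gradient h x, v⟫
      + L / 2 * ‖v‖ ^ 2 * s ^ 2)) (⟪gradient h (x + t • v), v⟫ - (⟪gradient h x, v⟫
      + L * ‖v‖ ^ 2 * t)) t := by
    have h₁ := ((hasDerivAt_id t).mul_const ⟪gradient h x, v⟫).add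
      ((hasDerivAt_pow 2 t).const_mul (L / 2 * ‖v‖ ^ 2))
    refine ((hL.1.hasDerivAt_line x v t).sub h₁).congr_deriv ?_
    norm_num
    ring
  have hanti := antitoneOn_of_deriv_nonpos (convex_Ici (0 : ℝ))
    (fun t _ => (hd t).continuousAt.continuousWithinAt)
    (fun t _ => (hd t).differentiableAt.differentiableWithinAt) (fun t ht => by
      rw [interior_Ici, Set.mem_Ioi] at ht
      rw [(hd t).deriv, sub_nonpos, ← sub_le_iff_le_add', ← inner_sub_left]
      refine (real_inner_le_norm _ _).trans ?_
      refine (mul_le_mul_of_nonneg_right (hL.2 _ _) (norm_nonneg v)).trans (le_of_eq ?_)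
      rw [add_sub_cancel_left, norm_smul, Real.norm_of_nonneg ht.le]
      ring)
  have := hanti (Set.mem_Ici.2 le_rfl) (Set.mem_Ici.2 zero_le_one) zero_le_one
  simp [-inner_gradient_left] at this
  linarith

/-- Compare, at the point x - (∇h x - ∇h y)/L, the quadratic upper bound from x with the tangent
lower bound from y. -/
theorem IsLSmooth.isCocoercive (hL : IsLSmooth L h) (hL0 : 0 < L)
    (hc : ConvexOn ℝ Set.univ h) :
    IsCocoercive (fun x => h x / L) (fun x => L⁻¹ • gradient h x) := by
  intro x y
  set w := gradient h x - gradient h y with hw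
  have h₁ := hL.le_quadratic x (-(L⁻¹ • w))
  have h₂ := hc.gradient_le hL.1 y (x + -(L⁻¹ • w))
  have e : ⟪gradient h y, x + -(L⁻¹ • w) - y⟫
      = ⟪gradient h y, x - y⟫ - L⁻¹ * ⟪gradient h y, w⟫ := by
    rw [← inner_smul_right, ← inner_sub_right]
    congr 1; abel
  have e' : ⟪gradient h x, w⟫ - ⟪gradient h y, w⟫ = ‖w‖ ^ 2 := by
    rw [← inner_sub_left, real_inner_self_eq_norm_sq]
  rw [e] at h₂
  rw [inner_neg_right, inner_smul_right, norm_neg, norm_smul, mul_pow, Real.norm_eq_abs,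
    sq_abs] at h₁
  have h₃ : h y + ⟪gradient h y, x - y⟫ + L⁻¹ / 2 * ‖w‖ ^ 2 ≤ h x := by
    have e₂ : L / 2 * (L⁻¹ ^ 2 * ‖w‖ ^ 2) = L⁻¹ / 2 * ‖w‖ ^ 2 := by field_simp
    rw [e₂] at h₁
    have e₃ : L⁻¹ * ⟪gradient h x, w⟫ - L⁻¹ * ⟪gradient h y, w⟫ = L⁻¹ * ‖w‖ ^ 2 := by
      rw [← mul_sub, e']
    linarith
  have h₄ := mul_le_mul_of_nonneg_left h₃ (inv_nonneg.2 hL0.le)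
  simp only
  rw [← smul_sub, ← hw, inner_smul_left, norm_smul, mul_pow, Real.norm_eq_abs, sq_abs]
  simp only [div_eq_inv_mul, map_inv₀, conj_trivial] at h₄ ⊢
  linarith

theorem IsMinOn.gradient_eq_zero {x : EuclideanSpace ℝ (Fin d)} (hx : IsMinOn h Set.univ x) :
    gradient h x = 0 := by
  have : fderiv ℝ h x = 0 := (hx.isLocalMin Filter.univ_mem).fderiv_eq_zero
  simp [gradient, this]

end Smooth

/-! ### Huber functions and tightness. -/

section Huber

open scoped RealInnerProductSpace

/-- Truncation of `t` to `[-δ, δ]`, the derivative of the Huber function. -/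
noncomputable def truncation (δ t : ℝ) : ℝ := max (-δ) (min t δ)

/-- The Huber function with threshold `δ`. -/
noncomputable def huber (δ t : ℝ) : ℝ := truncation δ t * t - truncation δ t ^ 2 / 2

variable {δ : ℝ}

theorem truncation_of_le {t : ℝ} (hδ : 0 ≤ δ) (h : δ ≤ t) : truncation δ t = δ := by
  rw [truncation, min_eq_right h, max_eq_right (by linarith)]

theorem truncation_zero (hδ : 0 ≤ δ) : truncation δ 0 = 0 := by
  rw [truncation, min_eq_left hδ, max_eq_right (by linarith)]

theorem abs_truncation_sub_le (s t : ℝ) : |truncation δ s - truncation δ t| ≤ |s - t| := by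
  unfold truncation
  refine (abs_max_sub_max_le_max _ _ _ _).trans ?_
  rw [sub_self, abs_zero, max_eq_right (abs_nonneg _)]
  refine (abs_min_sub_min_le_max _ _ _ _).trans ?_
  rw [sub_self, abs_zero, max_eq_left (abs_nonneg _)]

/-- The variational inequality of projection onto [-δ, δ]; it yields both Huber bounds below. -/
theorem truncation_variational (hδ : 0 ≤ δ) (s t : ℝ) :
    0 ≤ (s - truncation δ s) * (truncation δ s - truncation δ t) := by
  unfold truncation
  rcases le_total s δ with hs | hs <;> rcases le_total t δ with ht | ht <;>
  rcases le_total (-δ) s with hs' | hs' <;> rcases le_total (-δ) t with ht' | ht' <;>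
  simp only [min_eq_left, min_eq_right, max_eq_left, max_eq_right, hs, ht, hs', ht',
    neg_le_self hδ] <;> nlinarith

theorem huber_subgradient (hδ : 0 ≤ δ) (s t : ℝ) :
    huber δ t + truncation δ t * (s - t) ≤ huber δ s := by
  have := truncation_variational hδ s t
  unfold huber
  nlinarith [sq_nonneg (truncation δ s - truncation δ t)]

theorem huber_le_quadratic (hδ : 0 ≤ δ) (s t : ℝ) :
    huber δ s ≤ huber δ t + truncation δ t * (s - t) + (s - t) ^ 2 / 2 := by
  have := truncation_variational hδ t s
  unfold huber
  nlinarith [sq_nonneg (truncation δ s - truncation δ t - (s - t))]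

theorem hasDerivAt_huber (hδ : 0 ≤ δ) (t : ℝ) : HasDerivAt (huber δ) (truncation δ t) t := by
  rw [hasDerivAt_iff_isLittleO]
  -- The two bounds trap the first-order remainder between 0 and (s - t)²/2.
  refine Asymptotics.IsBigO.trans_isLittleO (g := fun s => (s - t) ^ 2) ?_ ?_
  · refine Asymptotics.IsBigO.of_bound (1 / 2) (Filter.Eventually.of_forall fun s => ?_)
    have h₁ := huber_subgradient hδ s t
    have h₂ := huber_le_quadratic hδ s t
    rw [smul_eq_mul, mul_comm (s - t), Real.norm_of_nonneg (by linarith),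
      Real.norm_of_nonneg (sq_nonneg _)]
    linarith
  · simpa using Asymptotics.isLittleO_pow_sub_sub t one_lt_two

theorem convexOn_huber (hδ : 0 ≤ δ) : ConvexOn ℝ Set.univ (huber δ) := by
  refine ⟨convex_univ, fun s _ t _ a b ha hb hab => ?_⟩
  have h₁ := mul_le_mul_of_nonneg_left (huber_subgradient hδ s (a • s + b • t)) ha
  have h₂ := mul_le_mul_of_nonneg_left (huber_subgradient hδ t (a • s + b • t)) hb
  simp only [smul_eq_mul] at *
  obtain rfl : b = 1 - a := by linarith
  linarith

theorem huber_zero (hδ : 0 ≤ δ) : huber δ 0 = 0 := by simp [huber, truncation_zero hδ]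

theorem huber_nonneg (hδ : 0 ≤ δ) (t : ℝ) : 0 ≤ huber δ t := by
  simpa [huber_zero hδ, truncation_zero hδ] using huber_subgradient hδ t 0

theorem List.sum_take_le_sum {l : List ℝ} (hl : ∀ a ∈ l, 0 ≤ a) (k : ℕ) :
    (l.take k).sum ≤ l.sum := by
  conv_rhs => rw [← List.take_append_drop k l, List.sum_append]
  exact le_add_of_nonneg_right (List.sum_nonneg fun a ha => hl a (List.mem_of_mem_drop ha))

/-- Gradient descent on a Huber function of one coordinate, started far enough from the minimizer
to stay in the region where the function is affine. -/
theorem exists_huber_descent {d : ℕ} {L : ℝ} (hL : 0 < L) {l : List ℝ} (hl : ∀ a ∈ l, 0 ≤ a)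
    {xstar x₀ : EuclideanSpace ℝ (Fin d)} (hne : x₀ ≠ xstar) (hδ : 0 ≤ δ)
    (hδx : (l.sum + 1) * δ ≤ ‖x₀ - xstar‖) :
    ∃ (h : EuclideanSpace ℝ (Fin d) → ℝ) (x : ℕ → EuclideanSpace ℝ (Fin d)),
      ConvexOn ℝ Set.univ h ∧ IsLSmooth L h ∧ IsMinOn h Set.univ xstar ∧
      IsGradientDescent L h l x₀ x ∧
      h (x l.length) - h xstar = L * (δ * (‖x₀ - xstar‖ - l.sum * δ) - δ ^ 2 / 2) ∧
      ‖gradient h (x l.length)‖ = L * δ := by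
  set D := ‖x₀ - xstar‖ with hD
  have hD0 : 0 < D := norm_pos_iff.2 (sub_ne_zero.2 hne)
  set e : EuclideanSpace ℝ (Fin d) := D⁻¹ • (x₀ - xstar) with he
  have hne' : ‖e‖ = 1 := by
    rw [he, norm_smul, norm_inv, Real.norm_of_nonneg hD0.le, ← hD, inv_mul_cancel₀ hD0.ne']
  have hinner : ⟪e, x₀ - xstar⟫ = D := by
    rw [he, real_inner_smul_left, real_inner_self_eq_norm_sq, ← hD]
    field_simp
  let h : EuclideanSpace ℝ (Fin d) → ℝ := fun x => L * huber δ ⟪e, x - xstar⟫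
  let x : ℕ → EuclideanSpace ℝ (Fin d) := fun k => x₀ - ((l.take k).sum * δ) • e
  have hgrad (z) : HasGradientAt h ((L * truncation δ ⟪e, z - xstar⟫) • e) z := by
    rw [hasGradientAt_iff_hasFDerivAt]
    have h₁ : HasFDerivAt (fun z => ⟪e, z - xstar⟫) (innerSL ℝ e) z :=
      (innerSL ℝ e).hasFDerivAt.comp z ((hasFDerivAt_id z).sub_const xstar)
    refine (((hasDerivAt_huber hδ _).comp_hasFDerivAt z h₁).const_mul L).congr_fderiv ?_
    ext v
    simp [mul_assoc]
  have hg (z) := (hgrad z).gradient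
  have hpos (k) : ⟪e, x k - xstar⟫ = D - (l.take k).sum * δ := by
    simp only [x]
    rw [sub_right_comm, inner_sub_right, hinner, real_inner_smul_right,
      real_inner_self_eq_norm_sq, hne']
    ring
  have htr (k) : truncation δ ⟪e, x k - xstar⟫ = δ := by
    refine truncation_of_le hδ ?_
    have := mul_le_mul_of_nonneg_right (List.sum_take_le_sum hl k) hδ
    rw [hpos]
    linarith
  refine ⟨h, x, ?_, ⟨fun z => (hgrad z).differentiableAt, fun z w => ?_⟩, ?_, ⟨?_, ?_⟩, ?_, ?_⟩
  · have h₁ := ((convexOn_huber hδ).comp_affineMap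
      ((innerSL ℝ e).toLinearMap.toAffineMap.comp
        (AffineMap.id ℝ (EuclideanSpace ℝ (Fin d)) - AffineMap.const ℝ _ xstar))).smul hL.le
    simpa [Function.comp_def, h] using h₁
  · rw [hg, hg, ← sub_smul, ← mul_sub, norm_smul, hne', mul_one, norm_mul,
      Real.norm_of_nonneg hL.le]
    refine mul_le_mul_of_nonneg_left ((abs_truncation_sub_le _ _).trans ?_) hL.le
    rw [← inner_sub_right, sub_sub_sub_cancel_right]
    simpa [hne'] using abs_real_inner_le_norm e (z - w)
  · intro z _
    simp only [Set.mem_ofPred_eq, h, sub_self, inner_zero_right, huber_zero hδ, mul_zero]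
    exact mul_nonneg hL.le (huber_nonneg hδ _)
  · simp [x]
  · intro k hk
    rw [hg, htr, smul_smul]
    simp only [x]
    rw [List.sum_take_succ l k hk, sub_sub, ← add_smul]
    congr 2
    field_simp
  · simp only [h]
    rw [sub_self, inner_zero_right, huber_zero hδ, huber, htr, hpos, List.take_length]
    ring
  · rw [hg, htr, norm_smul, hne', mul_one, Real.norm_of_nonneg (by positivity)]

end Huber

theorem mainTheorem1 (m : ℕ) (hm : 1 ≤ m) (d : ℕ) (L : ℝ) (hL : 0 < L) :
    -- the two convergence rates
    (∀ (h : EuclideanSpace ℝ (Fin d) → ℝ) (xstar x₀ : EuclideanSpace ℝ (Fin d))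
        (x : ℕ → EuclideanSpace ℝ (Fin d)),
        ConvexOn ℝ Set.univ h → IsLSmooth L h → IsMinOn h Set.univ xstar →
        IsGradientDescent L h (silverSchedule m) x₀ x →
        (h (x (2 ^ m - 1)) - h xstar
            ≤ L * ‖x₀ - xstar‖ ^ 2 / (2 * (2 * (silverSchedule m).sum + 1)) ∧
          L * ‖x₀ - xstar‖ ^ 2 / (2 * (2 * (silverSchedule m).sum + 1))
            = L * ‖x₀ - xstar‖ ^ 2 / (4 * silverRatio ^ m - 2)) ∧
        (‖gradient h (x (2 ^ m - 1))‖
            ≤ L * ‖x₀ - xstar‖ / ((silverSchedule m).sum + 1) ∧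
          L * ‖x₀ - xstar‖ / ((silverSchedule m).sum + 1)
            = L * ‖x₀ - xstar‖ / silverRatio ^ m)) ∧
    -- tightness of the first rate
    (∀ xstar x₀ : EuclideanSpace ℝ (Fin d), x₀ ≠ xstar →
        ∃ (h : EuclideanSpace ℝ (Fin d) → ℝ) (x : ℕ → EuclideanSpace ℝ (Fin d)),
          ConvexOn ℝ Set.univ h ∧ IsLSmooth L h ∧ IsMinOn h Set.univ xstar ∧
          IsGradientDescent L h (silverSchedule m) x₀ x ∧
          h (x (2 ^ m - 1)) - h xstar = L * ‖x₀ - xstar‖ ^ 2 / (4 * silverRatio ^ m - 2)) ∧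
    -- tightness of the second rate
    (∀ xstar x₀ : EuclideanSpace ℝ (Fin d), x₀ ≠ xstar →
        ∃ (h : EuclideanSpace ℝ (Fin d) → ℝ) (x : ℕ → EuclideanSpace ℝ (Fin d)),
          ConvexOn ℝ Set.univ h ∧ IsLSmooth L h ∧ IsMinOn h Set.univ xstar ∧
          IsGradientDescent L h (silverSchedule m) x₀ x ∧
          ‖gradient h (x (2 ^ m - 1))‖ = L * ‖x₀ - xstar‖ / silverRatio ^ m) := by
  have hS := silverSchedule_sum m
  have hlen := silverSchedule_length m
  have hρ : 1 ≤ silverRatio := by unfold silverRatio; linarith [Real.sqrt_nonneg 2]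
  have hρm : 1 ≤ silverRatio ^ m := one_le_pow₀ hρ
  have hS0 : 0 ≤ (silverSchedule m).sum := by linarith
  have e₁ : 2 * (2 * (silverSchedule m).sum + 1) = 4 * silverRatio ^ m - 2 := by rw [hS]; ring
  have e₂ : (silverSchedule m).sum + 1 = silverRatio ^ m := by rw [hS]; ring
  refine ⟨fun h xstar x₀ x hc hs hmin hx => ?_, fun xstar x₀ hne => ?_, fun xstar x₀ hne => ?_⟩
  · have hco := hs.isCocoercive hL hc
    have hpath : IsDescentPath (fun z => L⁻¹ • gradient h z) (silverSchedule m) x := by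
      intro k hk
      rw [hx.2 k hk, smul_smul, div_eq_mul_inv]
    have hb := hco.silver_bound m
    rw [← hS] at hb
    obtain ⟨h₁, h₂⟩ := hb.rates hco hS0 hpath (y := xstar) (by simp [hmin.gradient_eq_zero])
    rw [hx.1, hlen] at h₁ h₂
    refine ⟨⟨?_, by rw [e₁]⟩, ?_, by rw [e₂]⟩
    · rw [le_div_iff₀ (by positivity)]
      have := mul_le_mul_of_nonneg_left h₁ hL.le
      field_simp at this
      linarith
    · rw [le_div_iff₀ (by positivity)]
      rw [norm_smul, norm_inv, Real.norm_of_nonneg hL.le] at h₂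
      have := mul_le_mul_of_nonneg_left h₂ hL.le
      field_simp at this
      linarith
  · set D := ‖x₀ - xstar‖ with hD
    set S := (silverSchedule m).sum
    -- This δ maximizes δ(D - Sδ) - δ²/2.
    have hδ : 0 ≤ D / (2 * S + 1) := by positivity
    obtain ⟨h, x, hc, hs, hmin, hx, hval, -⟩ := exists_huber_descent hL (silverSchedule_nonneg m)
      hne hδ (by
        rw [mul_div_assoc', div_le_iff₀ (by positivity), mul_comm]
        exact mul_le_mul_of_nonneg_left (by linarith) (norm_nonneg _))
    refine ⟨h, x, hc, hs, hmin, hx, ?_⟩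
    rw [← hlen, hval, ← e₁, ← hD]
    field_simp
    ring
  -- The largest admissible δ: the last iterate lands on the edge of the affine region.
  · have hδ : 0 ≤ ‖x₀ - xstar‖ / ((silverSchedule m).sum + 1) := by positivity
    obtain ⟨h, x, hc, hs, hmin, hx, -, hval⟩ := exists_huber_descent hL (silverSchedule_nonneg m)
      hne hδ (mul_div_cancel₀ _ (by positivity)).le
    refine ⟨h, x, hc, hs, hmin, hx, ?_⟩
    rw [← hlen, hval, e₂, mul_div_assoc]
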